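/- Let $K$ be an algebraically closed field of characteristic zero and let $R$ be a finite-dimensional commutative associative local $K$-algebra with unit and maximal ideal $\mathfrak m$. For a hyperplane $V$ in $\mathfrak m$ (a $K$-subspace of codimension one) that generates $R$ as an algebra with unit, a symmetric $d$-linear form $F\colon R^d\to K$ is called *invariant with respect to $V$* if $F(1,\dots,1)=0$, the restriction of $F$ to $\mathfrak m$ is nonzero, and $$F(ab_1,b_2,\dots,b_d)+F(b_1,ab_2,\dots,b_d)+\dots+F(b_1,b_2,\dots,ab_d)=0\qquad\text{for all } a\in V,\ b_1,\dots,b_d\in R.$$ The form $F$ is called *invariant* if it is invariant with respect to some such $V$. An invariant form $F$ is called *irreducible* if it is not the product of two forms $F_1$, $F_2$ (of degrees $d_1+d_2=d$) that are invariant with respect to the same hyperplane; here the product is the symmetric one, $$(F_1F_2)(b_1,\dots,b_d)=\frac1{d!}\sum_{\sigma\in S_d}F_1(b_{\sigma(1)},\dots,b_{\sigma(d_1)})\,F_2(b_{\sigma(d_1+1)},\dots,b_{\sigma(d)}),$$ i.e. the polarization of the polynomial $v\mapsto F_1(v,\dots,v)F_2(v,\dots,v)$. Let $W$ be a hyperplane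 in $\mathfrak m$ that generates $R$ as an algebra with unit, and let $d$ be the maximal exponent such that $\mathfrak m^d\not\subseteq W$. Fix an isomorphism $\mathfrak m/W\cong K$ and let $\pi\colon\mathfrak m\to\mathfrak m/W\cong K$ be the projection. Then there is a unique $d$-linear form $F_W\colon R^d\to K$ such that, whenever each $b_i$ is either $1$ or an element of $\mathfrak m$, $$F_W(b_1,\dots,b_d)=(-1)^k\,k!\,(d-k-1)!\,\pi(b_1\cdots b_d),$$ where $k<d$ is the number of indices $i$ with $b_i=1$, and $F_W(1,\dots,1)=0$ (the case $k=d$). This form $F_W$ is invariant with respect to $W$, and it is an irreducible invariant $d$-linear form on $R$. -/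

import Mathlib

open IsLocalRing

namespace LocalAlgForm

variable {K R : Type*} [Field K] [CommRing R] [IsLocalRing R] [Algebra K R]

/-- `W` is a hyperplane (a subspace of codimension one) of the maximal ideal which generates `R`
as a `K`-algebra with unit. -/
structure IsGeneratingHyperplane (W : Submodule K (maximalIdeal R)) : Prop where
  codim_one : Module.finrank K (maximalIdeal R ⧸ W) = 1
  generates : Algebra.adjoin K ((fun x : maximalIdeal R => (x : R)) '' (W : Set (maximalIdeal R))) = ⊤

/-- The `d`-linear form `F` on `R` is invariant with respect to the subspace `W` of the maximal
ideal: it is symmetric, `F(1,…,1) = 0`, its restriction to the maximal ideal is nonzero, and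
`F(ab₁,b₂,…,b_d) + F(b₁,ab₂,…,b_d) + … + F(b₁,b₂,…,ab_d) = 0` for all `a ∈ W` and `bᵢ ∈ R`. -/
structure IsInvariantWrt (W : Submodule K (maximalIdeal R)) {d : ℕ}
    (F : MultilinearMap K (fun _ : Fin d => R) K) : Prop where
  symmetric : ∀ (σ : Equiv.Perm (Fin d)) (b : Fin d → R), F (fun i => b (σ i)) = F b
  map_one : F (fun _ => 1) = 0
  ne_zero : ∃ z : Fin d → R, (∀ i, z i ∈ maximalIdeal R) ∧ F z ≠ 0
  star : ∀ a ∈ W, ∀ b : Fin d → R, ∑ i, F (Function.update b i ((a : R) * b i)) = 0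

/-- An invariant `d`-linear form on `R`: one that is invariant with respect to some generating
hyperplane of the maximal ideal. -/
def IsInvariant {d : ℕ} (F : MultilinearMap K (fun _ : Fin d => R) K) : Prop :=
  ∃ W : Submodule K (maximalIdeal R), IsGeneratingHyperplane W ∧ IsInvariantWrt W F

/-- The product of two symmetric multilinear forms as a symmetric multilinear form, that is, the
polarization of the product of the polynomials `v ↦ F₁(v,…,v)` and `v ↦ F₂(v,…,v)`. -/
noncomputable def symProd {d₁ d₂ : ℕ} (F₁ : MultilinearMap K (fun _ : Fin d₁ => R) K)
    (F₂ : MultilinearMap K (fun _ : Fin d₂ => R) K) (b : Fin (d₁ + d₂) → R) : K :=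
  ((Nat.factorial (d₁ + d₂) : ℕ) : K)⁻¹ *
    ∑ σ : Equiv.Perm (Fin (d₁ + d₂)),
      F₁ (fun i => b (σ (Fin.castAdd d₂ i))) * F₂ (fun j => b (σ (Fin.natAdd d₁ j)))

/-- An irreducible invariant form: an invariant form that is not the product of two forms that are
invariant with respect to one and the same generating hyperplane. -/
def IsIrreducibleInvariant {d : ℕ} (F : MultilinearMap K (fun _ : Fin d => R) K) : Prop :=
  IsInvariant F ∧
    ¬ ∃ W : Submodule K (maximalIdeal R), IsGeneratingHyperplane W ∧
      ∃ (d₁ d₂ : ℕ) (h : d₁ + d₂ = d)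
        (F₁ : MultilinearMap K (fun _ : Fin d₁ => R) K)
        (F₂ : MultilinearMap K (fun _ : Fin d₂ => R) K),
        IsInvariantWrt W F₁ ∧ IsInvariantWrt W F₂ ∧
          ∀ b : Fin d → R, F b = symProd F₁ F₂ (fun i => b (Fin.cast h i))

/-- The projection `π : 𝔪 → 𝔪 / W ≅ K`. -/
def proj (W : Submodule K (maximalIdeal R)) (e : (maximalIdeal R ⧸ W) ≃ₗ[K] K) :
    maximalIdeal R →ₗ[K] K :=
  e.toLinearMap ∘ₗ W.mkQ

/-- The `d`-linear form `F` is given by the explicit formula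
`F(b₁,…,b_d) = (-1)ᵏ k! (d-k-1)! π(b₁⋯b_d)` on tuples whose entries are `1` or in the maximal
ideal, `k` being the number of entries equal to `1`, and by `F(1,…,1) = 0` if `k = d`.
(The product of such a tuple lies in the maximal ideal exactly if `k < d`.) -/
def HasExplicitFormula (W : Submodule K (maximalIdeal R)) (e : (maximalIdeal R ⧸ W) ≃ₗ[K] K)
    {d : ℕ} (F : MultilinearMap K (fun _ : Fin d => R) K) : Prop :=
  F (fun _ => 1) = 0 ∧
    ∀ b : Fin d → R, (∀ i, b i = 1 ∨ b i ∈ maximalIdeal R) →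
      ∀ h : ∏ i, b i ∈ maximalIdeal R,
        F b = (-1) ^ {i | b i = 1}.ncard * (Nat.factorial {i | b i = 1}.ncard : K) *
          (Nat.factorial (d - {i | b i = 1}.ncard - 1) : K) * proj W e ⟨∏ i, b i, h⟩

end LocalAlgForm

/-!
Write `v = x + z` with `x ∈ K` and `z ∈ 𝔪`. Up to the factor `(-1)ᵈ⁻¹ d!`, the form `F_W` is the
polarization of `v ↦ xᵈ π(log (1 + z / x))`, which is a polynomial because `π` vanishes on `𝔪ᵈ⁺¹`.
Multiplying `v` by `exp (t a)` with `a ∈ W` adds `t a` to the logarithm, which `π` does not see;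
this is the invariance. A product of two invariant forms vanishes to second order at `1`, whereas
the linear part of `F_W` at `1` is a nonzero multiple of `π`; this is the irreducibility.

On tuples with `0 < k < d` entries `1` and the others in `𝔪`, the invariance comes down to
`k c(k - 1) + (d - k) c(k) = 0` for the coefficients `c(k) = (-1)ᵏ k! (d - k - 1)!`. For `k = 0`
it holds since `π` vanishes on `𝔪ᵈ⁺¹`, and for `k = d` since `π(a) = 0`.
-/

namespace LocalAlgForm

section IdealPower

variable {K R : Type*} [CommSemiring K] [CommSemiring R] [Algebra K R]

theorem linearMap_eq_zero_of_mem_pow {M : Type*} [AddCommMonoid M] [Module K M] {φ : R →ₗ[K] M}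
    {I : Ideal R} {n : ℕ} (hn : n ≠ 0)
    (h : ∀ z : Fin n → R, (∀ i, z i ∈ I) → φ (∏ i, z i) = 0) {x : R} (hx : x ∈ I ^ n) :
    φ x = 0 := by
  suffices hle : (I ^ n).restrictScalars K ≤ LinearMap.ker φ from hle hx
  rw [Submodule.restrictScalars_pow hn, Submodule.pow_eq_span_pow_set, Submodule.span_le]
  intro y hy
  obtain ⟨z, rfl⟩ := Set.mem_pow.1 hy
  simpa only [List.prod_ofFn, SetLike.mem_coe, LinearMap.mem_ker] using
    h (fun i => z i) fun i => (z i).2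

end IdealPower

section Augmentation

variable {K R ι : Type*} [CommRing K] [CommRing R] [Algebra K R] (ε : R →ₐ[K] K)

/-- The projection onto the first summand of `R = K ⊕ ker ε`. -/
def scalarPart : R →ₗ[K] R :=
  Algebra.linearMap K R ∘ₗ ε.toLinearMap

/-- The projection onto the second summand of `R = K ⊕ ker ε`. -/
def kernelPart : R →ₗ[K] R :=
  LinearMap.id - scalarPart ε

variable {ε}

theorem scalarPart_apply (r : R) : scalarPart ε r = ε r • 1 :=
  Algebra.algebraMap_eq_smul_one _

theorem scalarPart_add_kernelPart (r : R) : scalarPart ε r + kernelPart ε r = r := by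
  simp [kernelPart]

theorem apply_kernelPart (r : R) : ε (kernelPart ε r) = 0 := by
  simp [kernelPart, scalarPart]

@[simp]
theorem scalarPart_one : scalarPart ε 1 = 1 := by
  simp [scalarPart_apply]

@[simp]
theorem kernelPart_one : kernelPart ε 1 = 0 := by
  simp [kernelPart]

theorem scalarPart_of_apply_eq_zero {r : R} (hr : ε r = 0) : scalarPart ε r = 0 := by
  simp [scalarPart_apply, hr]

theorem kernelPart_of_apply_eq_zero {r : R} (hr : ε r = 0) : kernelPart ε r = r := by
  simp [kernelPart, scalarPart_of_apply_eq_zero hr]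

theorem multilinearMap_ext_of_eq_one_or_apply_eq_zero [Finite ι] {M : Type*} [AddCommMonoid M]
    [Module K M] {F G : MultilinearMap K (fun _ : ι => R) M}
    (h : ∀ (S : Finset ι) (b : ι → R), (∀ i ∈ S, b i = 1) → (∀ i ∉ S, ε (b i) = 0) → F b = G b) :
    F = G := by
  classical
  have := Fintype.ofFinite ι
  ext b
  let z : ι → R := fun i => kernelPart ε (b i)
  have hb : b = (fun i => ε (b i) • (1 : R)) + z :=
    funext fun i => by simp [z, ← scalarPart_apply, scalarPart_add_kernelPart]
  have hexpand (H : MultilinearMap K (fun _ : ι => R) M) :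
      H b = ∑ S : Finset ι, (∏ i ∈ S, ε (b i)) • H (S.piecewise (fun _ => 1) z) := by
    conv_lhs => rw [hb, H.map_add_univ]
    refine Finset.sum_congr rfl fun S _ => ?_
    rw [← H.map_piecewise_smul]
    congr 1
    ext i
    by_cases hi : i ∈ S <;> simp [hi]
  rw [hexpand F, hexpand G]
  refine Finset.sum_congr rfl fun S _ => congrArg _ (h S _ (fun i hi => ?_) fun i hi => ?_)
  · simp [hi]
  · simpa [hi] using apply_kernelPart (b i)

end Augmentation

section WeightedForm

variable {K R ι : Type*} [CommRing K] [CommRing R] [Algebra K R] [Fintype ι] [DecidableEq ι]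
variable {ε : R →ₐ[K] K} {φ : R →ₗ[K] K} {c : ℕ → K}

variable (ε φ c ι) in
/-- The symmetric form with value `c k * φ (∏ i, b i)` on tuples `b` with `k` entries equal to `1`
and all others in `ker ε`. It is the sum over the sets `S` of positions at which the scalar part of
the argument is taken. -/
def weightedForm : MultilinearMap K (fun _ : ι => R) K :=
  ∑ S : Finset ι, c S.card • φ.compMultilinearMap
    ((MultilinearMap.mkPiAlgebra K ι R).compLinearMap
      (S.piecewise (fun _ => scalarPart ε) (fun _ => kernelPart ε)))

theorem weightedForm_apply (b : ι → R) :
    weightedForm ι ε φ c b = ∑ S : Finset ι, c S.card *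
      φ (∏ i, if i ∈ S then scalarPart ε (b i) else kernelPart ε (b i)) := by
  simp [weightedForm, Finset.piecewise, ite_apply, apply_ite]

theorem weightedForm_apply_of_eq_one_of_apply_eq_zero {S : Finset ι} {b : ι → R}
    (h₁ : ∀ i ∈ S, b i = 1) (h₀ : ∀ i ∉ S, ε (b i) = 0) :
    weightedForm ι ε φ c b = c S.card * φ (∏ i, b i) := by
  rw [weightedForm_apply, Finset.sum_eq_single_of_mem S (Finset.mem_univ S)]
  · congr 3 with i
    split_ifs with hi
    · simp [h₁ i hi]
    · exact kernelPart_of_apply_eq_zero (h₀ i hi)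
  · intro T _ hT
    obtain ⟨i, hi⟩ : ∃ i, ¬ (i ∈ T ↔ i ∈ S) := by
      simpa [Finset.ext_iff] using hT
    rw [Finset.prod_eq_zero (Finset.mem_univ i), map_zero, mul_zero]
    by_cases hiS : i ∈ S
    · have hiT : i ∉ T := by tauto
      simp [hiT, h₁ i hiS]
    · have hiT : i ∈ T := by tauto
      simp [hiT, scalarPart_of_apply_eq_zero (h₀ i hiS)]

theorem weightedForm_apply_perm (σ : Equiv.Perm ι) (b : ι → R) :
    weightedForm ι ε φ c (fun i => b (σ i)) = weightedForm ι ε φ c b := by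
  rw [weightedForm_apply, weightedForm_apply]
  refine Fintype.sum_equiv σ.finsetCongr _ _ fun S => ?_
  congr 2
  · simp
  · exact Fintype.prod_equiv σ _ _ fun i => by simp

theorem exists_weightedForm_apply_ne_zero [NoZeroDivisors K] {d : ℕ} (hd : d ≠ 0) (hc : c 0 ≠ 0)
    {x : R} (hx : x ∈ RingHom.ker ε ^ d) (hφ : φ x ≠ 0) :
    ∃ z : Fin d → R, (∀ i, ε (z i) = 0) ∧ weightedForm (Fin d) ε φ c z ≠ 0 := by
  contrapose! hφ
  refine linearMap_eq_zero_of_mem_pow hd (fun z hz => ?_) hx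
  have hval : weightedForm (Fin d) ε φ c z = c 0 * φ (∏ i, z i) := by
    simpa using weightedForm_apply_of_eq_one_of_apply_eq_zero (S := ∅) (by simp) fun i _ => hz i
  exact (mul_eq_zero.1 (hval ▸ hφ z hz)).resolve_left hc

theorem weightedForm_apply_update_one {r : R} (hr : ε r = 0) (i : ι) :
    weightedForm ι ε φ c (Function.update (fun _ => 1) i r) = c (Fintype.card ι - 1) * φ r := by
  rw [weightedForm_apply_of_eq_one_of_apply_eq_zero (S := Finset.univ.erase i)]
  · simp [Finset.prod_update_of_mem]
  · intro j hj
    simp [Finset.ne_of_mem_erase hj]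
  · intro j hj
    obtain rfl : j = i := by simpa using hj
    simpa using hr

theorem weightedForm_apply_update_mul {a : R} (ha : ε a = 0) {S : Finset ι} {b : ι → R}
    (h₁ : ∀ i ∈ S, b i = 1) (h₀ : ∀ i ∉ S, ε (b i) = 0) (i : ι) :
    weightedForm ι ε φ c (Function.update b i (a * b i)) =
      c (S.erase i).card * φ (a * ∏ j, b j) := by
  rw [weightedForm_apply_of_eq_one_of_apply_eq_zero (S := S.erase i)]
  · rw [Finset.prod_update_of_mem (Finset.mem_univ i), mul_assoc,
      ← Finset.prod_eq_mul_prod_sdiff_singleton_of_mem (Finset.mem_univ i)]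
  · intro j hj
    simp [Finset.ne_of_mem_erase hj, h₁ j (Finset.mem_of_mem_erase hj)]
  · intro j hj
    rcases eq_or_ne j i with rfl | hji
    · simp [ha]
    · simpa [hji] using h₀ j fun hjS => hj (Finset.mem_erase.2 ⟨hji, hjS⟩)

theorem sum_weightedForm_update_mul {a : R} (ha : ε a = 0) {S : Finset ι} {b : ι → R}
    (h₁ : ∀ i ∈ S, b i = 1) (h₀ : ∀ i ∉ S, ε (b i) = 0) :
    ∑ i, weightedForm ι ε φ c (Function.update b i (a * b i)) =
      (S.card * c (S.card - 1) + (Fintype.card ι - S.card : ℕ) * c S.card) *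
        φ (a * ∏ j, b j) := by
  have hin : ∑ i ∈ S, c (S.erase i).card = S.card * c (S.card - 1) := by
    rw [Finset.sum_congr rfl fun i hi => by rw [Finset.card_erase_of_mem hi], Finset.sum_const,
      nsmul_eq_mul]
  have hout : ∑ i ∈ Sᶜ, c (S.erase i).card = (Fintype.card ι - S.card : ℕ) * c S.card := by
    rw [Finset.sum_congr rfl fun i hi => by rw [Finset.erase_eq_of_notMem (Finset.mem_compl.1 hi)],
      Finset.sum_const, nsmul_eq_mul, Finset.card_compl]
  simp only [weightedForm_apply_update_mul ha h₁ h₀]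
  rw [← Finset.sum_mul, ← Finset.sum_add_sum_compl S, hin, hout]

end WeightedForm

section MulDerivation

variable {K R ι : Type*} [CommSemiring K] [CommSemiring R] [Algebra K R] [Fintype ι]
  [DecidableEq ι]

/-- The form `b ↦ F(ab₁, b₂, …) + F(b₁, ab₂, …) + ⋯`, whose vanishing is the invariance of `F`
under `a`. -/
def mulDerivation (a : R) (F : MultilinearMap K (fun _ : ι => R) K) :
    MultilinearMap K (fun _ : ι => R) K :=
  ∑ i, F.compLinearMap (Function.update (fun _ => LinearMap.id) i (LinearMap.mulLeft K a))

theorem mulDerivation_apply (a : R) (F : MultilinearMap K (fun _ : ι => R) K) (b : ι → R) :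
    mulDerivation a F b = ∑ i, F (Function.update b i (a * b i)) := by
  simp only [mulDerivation, sum_apply, MultilinearMap.compLinearMap_apply]
  refine Finset.sum_congr rfl fun i _ => congrArg F (funext fun j => ?_)
  rcases eq_or_ne j i with rfl | hji
  · simp
  · simp [hji]

end MulDerivation

section Coefficient

/-- The coefficient `(-1)ᵏ k! (d - k - 1)!` of `F_W`, meaningful for `k < d`. -/
def coeff (K : Type*) [Ring K] (d k : ℕ) : K :=
  (-1) ^ k * (k.factorial : K) * ((d - k - 1).factorial : K)

theorem coeff_recurrence {K : Type*} [CommRing K] {d k : ℕ} (hk : k ≠ 0) (hkd : k < d) :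
    k * coeff K d (k - 1) + (d - k : ℕ) * coeff K d k = 0 := by
  obtain ⟨k, rfl⟩ := Nat.exists_eq_add_one_of_ne_zero hk
  obtain ⟨m, rfl⟩ := Nat.exists_eq_add_of_lt hkd
  have h₁ : k + 1 + m + 1 - k - 1 = m + 1 := by lia
  have h₂ : k + 1 + m + 1 - (k + 1) = m + 1 := by lia
  simp only [coeff, Nat.add_sub_cancel, h₁, h₂, Nat.factorial_succ]
  push_cast
  ring

theorem coeff_zero {K : Type*} [Ring K] (d : ℕ) : coeff K d 0 = ((d - 1).factorial : K) := by
  simp [coeff]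

theorem coeff_pred {K : Type*} [Ring K] (d : ℕ) :
    coeff K d (d - 1) = (-1) ^ (d - 1) * ((d - 1).factorial : K) := by
  have h : d - (d - 1) - 1 = 0 := by lia
  simp [coeff, h]

theorem sum_weightedForm_coeff_update_mul_eq_zero {K R : Type*} [CommRing K] [CommRing R]
    [Algebra K R] {ε : R →ₐ[K] K} {φ : R →ₗ[K] K} {d : ℕ}
    (hφ : ∀ x ∈ RingHom.ker ε ^ (d + 1), φ x = 0) {a : R} (ha : ε a = 0) (hφa : φ a = 0)
    (b : Fin d → R) :
    ∑ i, weightedForm (Fin d) ε φ (coeff K d) (Function.update b i (a * b i)) = 0 := by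
  rw [← mulDerivation_apply]
  suffices h : mulDerivation a (weightedForm (Fin d) ε φ (coeff K d)) = 0 by simp [h]
  refine multilinearMap_ext_of_eq_one_or_apply_eq_zero (ε := ε) fun S b h₁ h₀ => ?_
  rw [mulDerivation_apply, sum_weightedForm_update_mul ha h₁ h₀, Fintype.card_fin, zero_apply]
  have hcard : S.card ≤ d := by simpa using S.card_le_univ
  rcases Nat.eq_zero_or_pos S.card with hS | hS
  · obtain rfl : S = ∅ := Finset.card_eq_zero.1 hS
    have hprod : ∏ i, b i ∈ RingHom.ker ε ^ d := by
      simpa using Ideal.prod_mem_prod (s := Finset.univ) (I := fun _ => RingHom.ker ε)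
        fun i _ => h₀ i (by simp)
    rw [hφ _ (pow_succ' (RingHom.ker ε) d ▸ Ideal.mul_mem_mul ha hprod), mul_zero]
  rcases hcard.lt_or_eq with hSd | hSd
  · rw [coeff_recurrence hS.ne' hSd, zero_mul]
  · obtain rfl : S = Finset.univ := by simpa [← Finset.card_eq_iff_eq_univ] using hSd
    rw [Finset.prod_eq_one h₁, mul_one, hφa, mul_zero]

end Coefficient

section LocalAlgebra

variable {K R : Type*} [Field K] [CommRing R] [IsLocalRing R] [Algebra K R]
variable {W : Submodule K (maximalIdeal R)} {e : (maximalIdeal R ⧸ W) ≃ₗ[K] K}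
variable {ε : R →ₐ[K] K} {d : ℕ}

theorem algebraMap_residueField_bijective {s : Set R} (hs : s ⊆ maximalIdeal R)
    (hgen : Algebra.adjoin K s = ⊤) : Function.Bijective (algebraMap K (ResidueField R)) := by
  let f : R →ₐ[K] ResidueField R := IsScalarTower.toAlgHom K R (ResidueField R)
  have hf : f.range = ⊤ := (AlgHom.range_eq_top f).2 residue_surjective
  rw [Algebra.bijective_algebraMap_iff, ← hf, eq_bot_iff, ← Algebra.map_top, ← hgen,
    AlgHom.map_adjoin, Algebra.adjoin_le_iff]
  rintro _ ⟨x, hx, rfl⟩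
  have hfx : f x = 0 := (residue_eq_zero_iff x).2 (hs hx)
  exact hfx ▸ zero_mem _

theorem IsGeneratingHyperplane.nonempty_algHom (hW : IsGeneratingHyperplane W) :
    Nonempty (R →ₐ[K] K) := by
  have hbij : Function.Bijective (algebraMap K (ResidueField R)) := by
    refine algebraMap_residueField_bijective ?_ hW.generates
    rintro _ ⟨x, _, rfl⟩
    exact x.2
  let f : K ≃ₐ[K] ResidueField R := AlgEquiv.ofBijective (Algebra.ofId K (ResidueField R)) hbij
  exact ⟨f.symm.toAlgHom.comp (IsScalarTower.toAlgHom K R (ResidueField R))⟩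

theorem ker_algHom_eq_maximalIdeal (ε : R →ₐ[K] K) : RingHom.ker ε = maximalIdeal R :=
  ker_eq_maximalIdeal (ε : R →+* K) fun x => ⟨algebraMap K R x, by simp⟩

theorem algHom_apply_eq_zero_iff (ε : R →ₐ[K] K) {x : R} : ε x = 0 ↔ x ∈ maximalIdeal R := by
  rw [← ker_algHom_eq_maximalIdeal ε, RingHom.mem_ker]

theorem proj_eq_zero_iff {x : maximalIdeal R} : proj W e x = 0 ↔ x ∈ W := by
  simp [proj]

theorem proj_surjective : Function.Surjective (proj W e) :=
  e.surjective.comp W.mkQ_surjective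

variable (ε W e) in
/-- The extension of `π` by zero on scalars to `R = K ⊕ 𝔪`. -/
def projExt : R →ₗ[K] K :=
  proj W e ∘ₗ (kernelPart ε).codRestrict ((maximalIdeal R).restrictScalars K) fun r =>
    (algHom_apply_eq_zero_iff ε).1 (apply_kernelPart r)

theorem projExt_one : projExt W e ε 1 = 0 :=
  (congrArg (proj W e) (Subtype.ext kernelPart_one)).trans (map_zero _)

theorem projExt_of_mem {x : R} (hx : x ∈ maximalIdeal R) : projExt W e ε x = proj W e ⟨x, hx⟩ :=
  congrArg (proj W e)
    (Subtype.ext (kernelPart_of_apply_eq_zero ((algHom_apply_eq_zero_iff ε).2 hx)))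

theorem projExt_eq_zero_iff {x : R} (hx : x ∈ maximalIdeal R) :
    projExt W e ε x = 0 ↔
      x ∈ (fun y : maximalIdeal R => (y : R)) '' (W : Set (maximalIdeal R)) := by
  rw [projExt_of_mem hx, proj_eq_zero_iff]
  refine ⟨fun h => ⟨_, h, rfl⟩, ?_⟩
  rintro ⟨y, hy, rfl⟩
  exact hy

theorem hasExplicitFormula_iff (ε : R →ₐ[K] K) {F : MultilinearMap K (fun _ : Fin d => R) K} :
    HasExplicitFormula W e F ↔ ∀ (S : Finset (Fin d)) (b : Fin d → R), (∀ i ∈ S, b i = 1) →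
      (∀ i ∉ S, ε (b i) = 0) → F b = coeff K d S.card * projExt W e ε (∏ i, b i) := by
  classical
  constructor
  · rintro ⟨hone, hF⟩ S b h₁ h₀
    have hS : {i | b i = 1} = S :=
      Set.ext fun i => ⟨fun hi => by_contra fun hiS => by simpa [hi.out] using h₀ i hiS, h₁ i⟩
    by_cases hall : ∀ i, b i = 1
    · obtain rfl : b = fun _ => 1 := funext hall
      simp [hone, projExt_one]
    · obtain ⟨i, hi⟩ := not_forall.1 hall
      have hmem (j : Fin d) (hj : j ∉ S) : b j ∈ maximalIdeal R :=
        (algHom_apply_eq_zero_iff ε).1 (h₀ j hj)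
      have hprod : ∏ j, b j ∈ maximalIdeal R :=
        Ideal.mem_of_dvd _ (Finset.dvd_prod_of_mem b (Finset.mem_univ i)) (hmem i (mt (h₁ i) hi))
      rw [hF b (fun j => or_iff_not_imp_left.2 fun hj => hmem j (mt (h₁ j) hj)) hprod, hS,
        Set.ncard_coe_finset, projExt_of_mem hprod, coeff]
  · intro hF
    refine ⟨?_, fun b hb hprod => ?_⟩
    · rw [hF Finset.univ _ (by simp) (by simp)]
      simp [projExt_one]
    · rw [hF {i | b i = 1} b (by simp) fun i hi => (algHom_apply_eq_zero_iff ε).2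
        ((hb i).resolve_left (by simpa using hi)), projExt_of_mem hprod, coeff,
        ← Set.ncard_coe_finset, Finset.coe_filter_univ]

theorem HasExplicitFormula.unique (ε : R →ₐ[K] K) {F G : MultilinearMap K (fun _ : Fin d => R) K}
    (hF : HasExplicitFormula W e F) (hG : HasExplicitFormula W e G) : F = G := by
  rw [hasExplicitFormula_iff ε] at hF hG
  exact multilinearMap_ext_of_eq_one_or_apply_eq_zero fun S b h₁ h₀ =>
    (hF S b h₁ h₀).trans (hG S b h₁ h₀).symm

variable (W e ε d) in
/-- The form `F_W` of degree `d`. -/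
def explicitForm : MultilinearMap K (fun _ : Fin d => R) K :=
  weightedForm (Fin d) ε (projExt W e ε) (coeff K d)

theorem hasExplicitFormula_explicitForm : HasExplicitFormula W e (explicitForm W e ε d) :=
  (hasExplicitFormula_iff ε).2 fun _ _ => weightedForm_apply_of_eq_one_of_apply_eq_zero

theorem isInvariantWrt_explicitForm (hd : d ≠ 0) (hfact : ((d - 1).factorial : K) ≠ 0)
    (hpow : ¬ ((maximalIdeal R ^ d : Ideal R) : Set R) ⊆
      (fun x : maximalIdeal R => (x : R)) '' (W : Set (maximalIdeal R)))
    (hpow_succ : ((maximalIdeal R ^ (d + 1) : Ideal R) : Set R) ⊆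
      (fun x : maximalIdeal R => (x : R)) '' (W : Set (maximalIdeal R))) :
    IsInvariantWrt W (explicitForm W e ε d) where
  symmetric := weightedForm_apply_perm
  map_one := hasExplicitFormula_explicitForm.1
  ne_zero := by
    obtain ⟨x, hx, hxW⟩ := Set.not_subset.1 hpow
    obtain ⟨z, hz, hFz⟩ := exists_weightedForm_apply_ne_zero (ε := ε) hd
      (coeff_zero (K := K) d ▸ hfact) (ker_algHom_eq_maximalIdeal ε ▸ hx)
      (mt (projExt_eq_zero_iff (e := e) (Ideal.pow_le_self hd hx)).1 hxW)
    exact ⟨z, fun i => (algHom_apply_eq_zero_iff ε).1 (hz i), hFz⟩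
  star a ha b := by
    refine sum_weightedForm_coeff_update_mul_eq_zero (fun x hx => ?_)
      ((algHom_apply_eq_zero_iff ε).2 a.2) ((projExt_eq_zero_iff a.2).2 ⟨a, ha, rfl⟩) b
    rw [ker_algHom_eq_maximalIdeal] at hx
    exact (projExt_eq_zero_iff (Ideal.pow_le_self d.succ_ne_zero hx)).2 (hpow_succ hx)

theorem exists_explicitForm_update_one_ne_zero (hfact : ((d - 1).factorial : K) ≠ 0) (i : Fin d) :
    ∃ r : R, explicitForm W e ε d (Function.update (fun _ => 1) i r) ≠ 0 := by
  obtain ⟨z, hz⟩ := proj_surjective (W := W) (e := e) 1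
  refine ⟨z, ?_⟩
  rw [explicitForm, weightedForm_apply_update_one ((algHom_apply_eq_zero_iff ε).2 z.2),
    projExt_of_mem z.2, hz, Fintype.card_fin, coeff_pred]
  simpa using hfact

theorem ne_zero_of_isGreatest_not_pow_subset (e : (maximalIdeal R ⧸ W) ≃ₗ[K] K)
    (hd : IsGreatest {j : ℕ | ¬ ((maximalIdeal R ^ j : Ideal R) : Set R) ⊆
      (fun x : maximalIdeal R => (x : R)) '' (W : Set (maximalIdeal R))} d) : d ≠ 0 := by
  obtain ⟨z, hz⟩ := proj_surjective (W := W) (e := e) 1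
  refine Nat.one_le_iff_ne_zero.1 (hd.2 fun hsub => ?_)
  obtain ⟨w, hw, hwz⟩ := hsub (by simp : (z : R) ∈ _)
  obtain rfl : w = z := Subtype.ext hwz
  exact one_ne_zero (hz.symm.trans (proj_eq_zero_iff.2 hw))

end LocalAlgebra

section Irreducibility

variable {K R : Type*} [Field K] [CommRing R] [Algebra K R]

theorem symProd_update_one_eq_zero {d₁ d₂ : ℕ} {F₁ : MultilinearMap K (fun _ : Fin d₁ => R) K}
    {F₂ : MultilinearMap K (fun _ : Fin d₂ => R) K} (h₁ : F₁ (fun _ => 1) = 0)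
    (h₂ : F₂ (fun _ => 1) = 0) (i : Fin (d₁ + d₂)) (r : R) :
    symProd F₁ F₂ (Function.update (fun _ => 1) i r) = 0 := by
  rw [symProd, Finset.sum_eq_zero, mul_zero]
  intro σ _
  obtain ⟨k, rfl⟩ := σ.surjective i
  have hne (j : Fin d₁) (l : Fin d₂) : Fin.castAdd d₂ j ≠ Fin.natAdd d₁ l :=
    Fin.ne_of_lt (by simp [Fin.lt_def]; lia)
  cases k using Fin.addCases with
  | left k =>
    have hone : (fun j => Function.update (fun _ => (1 : R)) (σ (Fin.castAdd d₂ k)) r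
        (σ (Fin.natAdd d₁ j))) = fun _ => 1 :=
      Function.update_comp_eq_of_forall_ne _ _ fun j => σ.injective.ne (hne k j).symm
    rw [hone, h₂, mul_zero]
  | right k =>
    have hone : (fun j => Function.update (fun _ => (1 : R)) (σ (Fin.natAdd d₁ k)) r
        (σ (Fin.castAdd d₂ j))) = fun _ => 1 :=
      Function.update_comp_eq_of_forall_ne _ _ fun j => σ.injective.ne (hne j k)
    rw [hone, h₁, zero_mul]

theorem IsInvariant.isIrreducibleInvariant [IsLocalRing R] {d : ℕ}
    {F : MultilinearMap K (fun _ : Fin d => R) K} (hF : IsInvariant F) {i : Fin d} {r : R}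
    (hr : F (Function.update (fun _ => 1) i r) ≠ 0) : IsIrreducibleInvariant F := by
  refine ⟨hF, ?_⟩
  rintro ⟨_, _, _, _, rfl, F₁, F₂, h₁, h₂, hprod⟩
  exact hr ((hprod _).trans (symProd_update_one_eq_zero h₁.map_one h₂.map_one i r))

end Irreducibility

end LocalAlgForm

open LocalAlgForm in
theorem lemma3_general {K R : Type*} [Field K] [CommRing R] [IsLocalRing R] [Algebra K R]
    (W : Submodule K (maximalIdeal R)) (hW : IsGeneratingHyperplane W)
    (d : ℕ) (hfact : (d.factorial : K) ≠ 0)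
    (hd : IsGreatest {j : ℕ | ¬ ((maximalIdeal R ^ j : Ideal R) : Set R) ⊆
      (fun x : maximalIdeal R => (x : R)) '' (W : Set (maximalIdeal R))} d)
    (e : (maximalIdeal R ⧸ W) ≃ₗ[K] K) :
    ∃ F : MultilinearMap K (fun _ : Fin d => R) K,
      HasExplicitFormula W e F ∧
      (∀ G : MultilinearMap K (fun _ : Fin d => R) K,
        HasExplicitFormula W e G → G = F) ∧
      IsInvariantWrt W F ∧
      IsIrreducibleInvariant F := by
  obtain ⟨ε⟩ := hW.nonempty_algHom
  have hd₀ : d ≠ 0 := ne_zero_of_isGreatest_not_pow_subset e hd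
  have hfact_pred : ((d - 1).factorial : K) ≠ 0 := by
    rw [← Nat.mul_factorial_pred hd₀, Nat.cast_mul] at hfact
    exact right_ne_zero_of_mul hfact
  have hinv : IsInvariantWrt W (explicitForm W e ε d) :=
    isInvariantWrt_explicitForm hd₀ hfact_pred hd.1
      (not_not.1 fun h => absurd (hd.2 h) (by simp))
  obtain ⟨r, hr⟩ := exists_explicitForm_update_one_ne_zero (W := W) (e := e) (ε := ε) hfact_pred
    ⟨0, Nat.pos_of_ne_zero hd₀⟩
  exact ⟨explicitForm W e ε d, hasExplicitFormula_explicitForm,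
    fun G hG => hG.unique ε hasExplicitFormula_explicitForm, hinv,
    IsInvariant.isIrreducibleInvariant ⟨W, hW, hinv⟩ hr⟩

theorem lemma3 {K R : Type*} [Field K] [IsAlgClosed K] [CharZero K]
    [CommRing R] [IsLocalRing R] [Algebra K R] [FiniteDimensional K R]
    (W : Submodule K (IsLocalRing.maximalIdeal R)) (hW : LocalAlgForm.IsGeneratingHyperplane W)
    (d : ℕ)
    (hd : IsGreatest {j : ℕ | ¬ ((IsLocalRing.maximalIdeal R ^ j : Ideal R) : Set R) ⊆
      (fun x : IsLocalRing.maximalIdeal R => (x : R)) '' (W : Set (IsLocalRing.maximalIdeal R))} d)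
    (e : (IsLocalRing.maximalIdeal R ⧸ W) ≃ₗ[K] K) :
    ∃ F : MultilinearMap K (fun _ : Fin d => R) K,
      LocalAlgForm.HasExplicitFormula W e F ∧
      (∀ G : MultilinearMap K (fun _ : Fin d => R) K,
        LocalAlgForm.HasExplicitFormula W e G → G = F) ∧
      LocalAlgForm.IsInvariantWrt W F ∧
      LocalAlgForm.IsIrreducibleInvariant F :=
  lemma3_general W hW d (Nat.cast_ne_zero.2 d.factorial_ne_zero) hd e
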